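/- Let $1<p<\infty$ and let $V:\mathbb{R}\to\mathbb{R}$ satisfy (V1) $V\in L^1_{\rm loc}(\mathbb{R})\cap C^1(\mathbb{R}\setminus\{0\})$ is even, $V$ is a non-decreasing function of $r=|x|$ on $(0,\infty)$, and $\partial_xV\not\equiv0$ on $\mathbb{R}\setminus\{0\}$. Put $X=\{u\in H^1(\mathbb{R};\mathbb{C}) : V|u|^2\in L^1(\mathbb{R})\}$ and $$\omega_1=-\inf\Bigl\{\int_{\mathbb{R}}\bigl(|u_x|^2+V|u|^2\bigr)\,dx : u\in X,\ \|u\|_{L^2}=1\Bigr\},$$ and let $\omega>\omega_1$. For $u\in X$ put $$S_\omega(u)=\frac12\int_{\mathbb{R}}\bigl(|u_x|^2+V|u|^2\bigr)\,dx-\frac1{p+1}\|u\|_{L^{p+1}}^{p+1}+\frac{\omega}{2}\|u\|_{L^2}^2,$$ $$K_\omega(u)=\int_{\mathbb{R}}\bigl(|u_x|^2+V|u|^2+\omega|u|^2\bigr)\,dx-\|u\|_{L^{p+1}}^{p+1},$$ $$d(\omega)=\inf\{S_\omega(u) : u\in X\setminus\{0\},\ K_\omega(u)=0\},\qquad \mathcal{M}_\omega=\{u\in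 X : K_\omega(u)=0,\ S_\omega(u)=d(\omega)\}.$$ Then for every $u\in\mathcal{M}_\omega$ there is $\theta\in\mathbb{R}$ such that $e^{i\theta}u$ is a positive function, that is, $e^{i\theta}u$ coincides almost everywhere with a continuous function $v:\mathbb{R}\to\mathbb{R}$ such that $v(x)>0$ for all $x\in\mathbb{R}$. -/

import Mathlib

open MeasureTheory

noncomputable section

namespace NLS

/-- `g` is the weak (distributional) derivative of `u` on the real line. -/
def HasWeakDeriv (u g : ℝ → ℂ) : Prop :=
  LocallyIntegrable u volume ∧ LocallyIntegrable g volume ∧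
    ∀ φ : ℝ → ℝ, ContDiff ℝ (⊤ : ℕ∞) φ → HasCompactSupport φ →
      ∫ x, deriv φ x • u x = -∫ x, φ x • g x

/-- The Sobolev space `H¹(ℝ; ℂ)`: square-integrable functions with a square-integrable weak
derivative. Elements are functions, to be identified when they agree almost everywhere. -/
def H1 : Set (ℝ → ℂ) :=
  {u | MemLp u 2 volume ∧ ∃ g : ℝ → ℂ, MemLp g 2 volume ∧ HasWeakDeriv u g}

open Classical in
/-- A weak derivative `u_x` of `u` (zero if there is none). It is unique up to equality almost
everywhere, see `HasWeakDeriv.weakDeriv_ae_eq`. -/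
def weakDeriv (u : ℝ → ℂ) : ℝ → ℂ :=
  if h : ∃ g : ℝ → ℂ, HasWeakDeriv u g then h.choose else 0

/-- The weak derivative is unique almost everywhere and depends only on the class of `u`. -/
theorem HasWeakDeriv.ae_eq {u v g h : ℝ → ℂ} (huv : u =ᵐ[volume] v)
    (hg : HasWeakDeriv u g) (hh : HasWeakDeriv v h) : g =ᵐ[volume] h := by
  refine ae_eq_of_integral_contDiff_smul_eq hg.2.1 hh.2.1 ?_
  intro φ hφ hc
  have h1 := hg.2.2 φ hφ hc
  have h2 := hh.2.2 φ hφ hc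
  have h3 : ∫ x, deriv φ x • u x = ∫ x, deriv φ x • v x := by
    refine integral_congr_ae ?_
    filter_upwards [huv] with x hx
    rw [hx]
  rw [h1, h2] at h3
  exact neg_injective h3

theorem HasWeakDeriv.weakDeriv_ae_eq {u g : ℝ → ℂ} (hg : HasWeakDeriv u g) :
    weakDeriv u =ᵐ[volume] g := by
  have h : ∃ g : ℝ → ℂ, HasWeakDeriv u g := ⟨g, hg⟩
  have h' : HasWeakDeriv u (weakDeriv u) := by
    unfold weakDeriv
    rw [dif_pos h]
    exact h.choose_spec
  exact h'.ae_eq Filter.EventuallyEq.rfl hg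

/-- Condition (V1): `V ∈ L¹_loc(ℝ) ∩ C¹(ℝ ∖ {0})` is even, non-decreasing in `r = |x| > 0`, and
its derivative on `ℝ ∖ {0}` does not vanish identically. -/
structure CondV1 (V : ℝ → ℝ) : Prop where
  locallyIntegrable : LocallyIntegrable V volume
  contDiffOn : ContDiffOn ℝ 1 V {0}ᶜ
  even : ∀ x, V (-x) = V x
  monotone : MonotoneOn V (Set.Ioi 0)
  deriv_ne_zero : ∃ x, x ≠ 0 ∧ deriv V x ≠ 0

/-- `X = {u ∈ H¹(ℝ) : V |u|² ∈ L¹(ℝ)}`. -/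
def X (V : ℝ → ℝ) : Set (ℝ → ℂ) :=
  {u | u ∈ H1 ∧ Integrable (fun x => V x * ‖u x‖ ^ 2) volume}

/-- `ω₁ = - inf {∫ (|u_x|² + V |u|²) : u ∈ X, ‖u‖_{L²} = 1}`, the infimum being taken in the
extended reals. -/
def omega1 (V : ℝ → ℝ) : EReal :=
  -(⨅ u ∈ {u : ℝ → ℂ | u ∈ X V ∧ ∫ x, ‖u x‖ ^ 2 = 1},
      ((∫ x, (‖weakDeriv u x‖ ^ 2 + V x * ‖u x‖ ^ 2) : ℝ) : EReal))

/-- The energy `E(u) = ½ ∫ (|u_x|² + V |u|²) - 1/(p+1) ‖u‖_{L^{p+1}}^{p+1}`. -/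
def energy (V : ℝ → ℝ) (p : ℝ) (u : ℝ → ℂ) : ℝ :=
  1 / 2 * (∫ x, (‖weakDeriv u x‖ ^ 2 + V x * ‖u x‖ ^ 2))
    - 1 / (p + 1) * ∫ x, ‖u x‖ ^ (p + 1)

/-- The action `S_ω(u) = E(u) + ω/2 ‖u‖_{L²}²`. -/
def action (V : ℝ → ℝ) (p ω : ℝ) (u : ℝ → ℂ) : ℝ :=
  energy V p u + ω / 2 * ∫ x, ‖u x‖ ^ 2

/-- `‖u‖_{X_ω}² = ∫ (|u_x|² + V |u|² + ω |u|²)`. -/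
def normXSq (V : ℝ → ℝ) (ω : ℝ) (u : ℝ → ℂ) : ℝ :=
  ∫ x, (‖weakDeriv u x‖ ^ 2 + V x * ‖u x‖ ^ 2 + ω * ‖u x‖ ^ 2)

/-- The Nehari functional `K_ω(u) = ‖u‖_{X_ω}² - ‖u‖_{L^{p+1}}^{p+1}`. -/
def nehari (V : ℝ → ℝ) (p ω : ℝ) (u : ℝ → ℂ) : ℝ :=
  normXSq V ω u - ∫ x, ‖u x‖ ^ (p + 1)

/-- `d(ω) = inf {S_ω(u) : u ∈ X ∖ {0}, K_ω(u) = 0}`, the infimum being taken in the extended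
reals; `u ≠ 0` in `X` means that `u` is not almost everywhere zero. -/
def dLevel (V : ℝ → ℝ) (p ω : ℝ) : EReal :=
  ⨅ u ∈ {u : ℝ → ℂ | u ∈ X V ∧ ¬ u =ᵐ[volume] 0 ∧ nehari V p ω u = 0},
    (action V p ω u : EReal)

/-- `M_ω = {u ∈ X : K_ω(u) = 0, S_ω(u) = d(ω)}`. -/
def minimizers (V : ℝ → ℝ) (p ω : ℝ) : Set (ℝ → ℂ) :=
  {u | u ∈ X V ∧ nehari V p ω u = 0 ∧ (action V p ω u : EReal) = dLevel V p ω}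

end NLS

end

/-! On the Nehari set the action is a positive multiple of the quadratic form, and every nonzero
function can be scaled onto that set. Hence a minimiser also minimises the scale-invariant quotient
`quad ^ ((p + 1) / 2) / power` over all nonzero functions of `X`
(`exists_optimal_of_mem_minimizers`). Minimality is thus unconstrained. Its first variation gives
`u'' = (V + ω - |u|^(p-1)) u`, so the continuous representative of `u` is `C¹`.

Positivity comes from cutting and reflecting. Let `T` be a real-linear isometry of `ℂ` fixing `u a`.
Replacing `u` by `T ∘ u` to the right of `a` keeps the function in `X` and changes neither
functional, so the new function is again optimal (`Optimal.flip`), hence differentiable at `a`.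
Comparing one-sided derivatives gives `T (u' a) = u' a` (`Optimal.map_deriv_eq`).

Two choices of `T` suffice. If `u a = 0`, then `T = -1` gives `u' a = 0`, and uniqueness for the
linear equation forces `u = 0`; so `u` has no zeros (`Optimal.ne_zero`). If `T` is the reflection in
the real line spanned by `u a`, then `u' a` is a real multiple of `u a`; so the phase of `u` is
constant (`Optimal.exists_rotation`). -/

noncomputable section

namespace NLS

/-! ### Primitives and weak derivatives on the line -/

/-- `u` is an antiderivative of the locally integrable function `g`. -/
structure IsPrimitive (u g : ℝ → ℂ) : Prop where
  locallyIntegrable : LocallyIntegrable g volume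
  sub_eq : ∀ x y, u y - u x = ∫ t in x..y, g t

theorem _root_.MeasureTheory.LocallyIntegrable.intervalIntegrable_real {E : Type*}
    [NormedAddCommGroup E] {g : ℝ → E} (hg : LocallyIntegrable g volume) (a b : ℝ) :
    IntervalIntegrable g volume a b :=
  intervalIntegrable_iff.mpr <|
    (hg.integrableOn_isCompact isCompact_uIcc).mono_set Set.uIoc_subset_uIcc

theorem isPrimitive_integral {g : ℝ → ℂ} (hg : LocallyIntegrable g volume) (c : ℂ) (a : ℝ) :
    IsPrimitive (fun x => c + ∫ t in a..x, g t) g := by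
  refine ⟨hg, fun x y => ?_⟩
  have := intervalIntegral.integral_add_adjacent_intervals (hg.intervalIntegrable_real a x)
    (hg.intervalIntegrable_real x y)
  simp only [← this]
  ring

namespace IsPrimitive

variable {u v g h : ℝ → ℂ}

theorem eq_add (hu : IsPrimitive u g) (a x : ℝ) : u x = u a + ∫ t in a..x, g t := by
  rw [← hu.sub_eq]; ring

protected theorem continuous (hu : IsPrimitive u g) : Continuous u := by
  have : u = fun x => u 0 + ∫ t in (0 : ℝ)..x, g t := funext fun x => hu.eq_add 0 x
  rw [this]
  exact continuous_const.add
    (intervalIntegral.continuous_primitive hu.locallyIntegrable.intervalIntegrable_real 0)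

theorem congr_ae (hu : IsPrimitive u g) (hgh : g =ᵐ[volume] h) : IsPrimitive u h := by
  refine ⟨(locallyIntegrable_congr hgh).1 hu.locallyIntegrable, fun x y => ?_⟩
  rw [hu.sub_eq]
  exact intervalIntegral.integral_congr_ae (hgh.mono fun x hx _ => hx)

theorem hasDerivAt (hu : IsPrimitive u g) (hg : Continuous g) (x : ℝ) : HasDerivAt u (g x) x := by
  have : u = fun x => u 0 + ∫ t in (0 : ℝ)..x, g t := funext fun x => hu.eq_add 0 x
  rw [this]
  exact (hg.integral_hasStrictDerivAt 0 x).hasDerivAt.const_add _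

theorem add (hu : IsPrimitive u g) (hv : IsPrimitive v h) :
    IsPrimitive (fun x => u x + v x) (fun x => g x + h x) := by
  refine ⟨hu.locallyIntegrable.add hv.locallyIntegrable, fun x y => ?_⟩
  rw [intervalIntegral.integral_add (hu.locallyIntegrable.intervalIntegrable_real x y)
    (hv.locallyIntegrable.intervalIntegrable_real x y), ← hu.sub_eq, ← hv.sub_eq]
  ring

theorem clm (hu : IsPrimitive u g) (T : ℂ →L[ℝ] ℂ) :
    IsPrimitive (fun x => T (u x)) (fun x => T (g x)) := by
  refine ⟨fun x => ?_, fun x y => ?_⟩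
  · obtain ⟨s, hs, hg⟩ := hu.locallyIntegrable x
    exact ⟨s, hs, T.integrable_comp hg⟩
  · rw [T.intervalIntegral_comp_comm (hu.locallyIntegrable.intervalIntegrable_real x y),
      ← hu.sub_eq, map_sub]

theorem smul (hu : IsPrimitive u g) (c : ℝ) :
    IsPrimitive (fun x => c • u x) (fun x => c • g x) := by
  simpa using hu.clm (c • ContinuousLinearMap.id ℝ ℂ)

end IsPrimitive

/-- Integration by parts for absolutely continuous functions on an interval containing the support
of `φ`; by Lebesgue differentiation the primitive has derivative `f` almost everywhere. -/
theorem integral_deriv_mul_primitive {φ f : ℝ → ℝ} (hφ : ContDiff ℝ (⊤ : ℕ∞) φ)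
    (hc : HasCompactSupport φ) (hf : LocallyIntegrable f volume) (c : ℝ) :
    ∫ x, deriv φ x * (c + ∫ t in (0 : ℝ)..x, f t) = -∫ x, φ x * f x := by
  obtain ⟨R, hR, hs⟩ : ∃ R : ℝ, 0 < R ∧ tsupport φ ⊆ Set.Ioo (-R) R := by
    obtain ⟨R, hR⟩ := hc.isCompact.isBounded.subset_ball_lt 0 0
    exact ⟨R, hR.1, by simpa [Real.ball_eq_Ioo] using hR.2⟩
  have hz : ∀ x, x ∉ Set.Ioo (-R) R → φ x = 0 := fun x hx =>
    image_eq_zero_of_notMem_tsupport fun h => hx (hs h)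
  have hz' : ∀ x, x ∉ Set.Ioo (-R) R → deriv φ x = 0 := fun x hx =>
    image_eq_zero_of_notMem_tsupport fun h => hx (hs (tsupport_deriv_subset h))
  have hsub : ∀ F : ℝ → ℝ, (∀ x, x ∉ Set.Ioo (-R) R → F x = 0) →
      ∫ x, F x = ∫ x in (-R)..R, F x := fun F hF => by
    refine (intervalIntegral.integral_eq_integral_of_support_subset ?_).symm
    intro x hx
    by_contra h
    exact hx (hF x fun h' => h (Set.Ioo_subset_Ioc_self h'))
  set G : ℝ → ℝ := fun x => c + ∫ t in (0 : ℝ)..x, f t with hG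
  have hGac : AbsolutelyContinuousOnInterval G (-R) R := by
    have h1 := (hf.intervalIntegrable_real (-R) R).absolutelyContinuousOnInterval_intervalIntegral
      (c := 0) (by rw [Set.mem_uIcc]; left; constructor <;> linarith)
    have h2 : AbsolutelyContinuousOnInterval (fun _ : ℝ => c) (-R) R :=
      (contDiff_const (𝕜 := ℝ) (n := 1)).contDiffOn.absolutelyContinuousOnInterval
    exact h2.add h1
  have hφac : AbsolutelyContinuousOnInterval φ (-R) R :=
    (hφ.of_le (by exact_mod_cast le_top) : ContDiff ℝ 1 φ).contDiffOn.absolutelyContinuousOnInterval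
  have hparts := hφac.integral_mul_deriv_eq_deriv_mul hGac
  have hd : ∀ᵐ x, deriv G x = f x := by
    filter_upwards [_root_.LocallyIntegrable.ae_hasDerivAt_integral hf] with x hx
    exact ((hx 0).const_add c).deriv
  rw [hsub _ fun x hx => by rw [hz' x hx, zero_mul], hsub _ fun x hx => by rw [hz x hx, zero_mul]]
  rw [hz (-R) (by simp), hz R (by simp)] at hparts
  have h3 : ∫ x in (-R)..R, φ x * deriv G x = ∫ x in (-R)..R, φ x * f x :=
    intervalIntegral.integral_congr_ae (hd.mono fun x hx _ => by rw [hx])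
  rw [← h3, hparts]
  simp [hG]

theorem _root_.MeasureTheory.LocallyIntegrable.integrable_smul_of_compact_support {φ : ℝ → ℝ}
    {f : ℝ → ℂ} (hf : LocallyIntegrable f volume) (hφ : Continuous φ) (hc : HasCompactSupport φ) :
    Integrable (fun x => φ x • f x) volume :=
  hf.integrable_smul_left_of_hasCompactSupport hφ hc

theorem IsPrimitive.hasWeakDeriv {u g : ℝ → ℂ} (hu : IsPrimitive u g) : HasWeakDeriv u g := by
  refine ⟨hu.continuous.locallyIntegrable, hu.locallyIntegrable, fun φ hφ hc => ?_⟩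
  have hi1 : Integrable (fun x => deriv φ x • u x) volume :=
    hu.continuous.locallyIntegrable.integrable_smul_of_compact_support
      (hφ.continuous_deriv (by exact_mod_cast le_top)) hc.deriv
  have hi2 : Integrable (fun x => φ x • g x) volume :=
    hu.locallyIntegrable.integrable_smul_of_compact_support hφ.continuous hc
  have key : ∀ L : ℂ →L[ℝ] ℝ, L (∫ x, deriv φ x • u x) = L (-∫ x, φ x • g x) := by
    intro L
    have hL : LocallyIntegrable (fun x => L (g x)) volume := fun x => by
      obtain ⟨s, hs, hg⟩ := hu.locallyIntegrable x
      exact ⟨s, hs, L.integrable_comp hg⟩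
    rw [map_neg, ← L.integral_comp_comm hi1, ← L.integral_comp_comm hi2]
    have := integral_deriv_mul_primitive hφ hc hL (L (u 0))
    simp only [map_smul, smul_eq_mul]
    rw [← this]
    congr 1 with x
    rw [hu.eq_add 0 x, map_add,
      L.intervalIntegral_comp_comm (hu.locallyIntegrable.intervalIntegrable_real 0 x)]
  exact Complex.ext (key Complex.reCLM) (key Complex.imCLM)

/-- The primitive started to the left of the support vanishes there, and equals the total integral,
hence zero, to the right of it. -/
theorem exists_contDiff_primitive_of_integral_eq_zero {φ : ℝ → ℝ} (hφ : ContDiff ℝ (⊤ : ℕ∞) φ)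
    (hc : HasCompactSupport φ) (h0 : ∫ x, φ x = 0) :
    ∃ χ : ℝ → ℝ, ContDiff ℝ (⊤ : ℕ∞) χ ∧ HasCompactSupport χ ∧ deriv χ = φ := by
  obtain ⟨R, hR, hs⟩ : ∃ R : ℝ, 0 < R ∧ tsupport φ ⊆ Set.Ioo (-R) R := by
    obtain ⟨R, hR⟩ := hc.isCompact.isBounded.subset_ball_lt 0 0
    exact ⟨R, hR.1, by simpa [Real.ball_eq_Ioo] using hR.2⟩
  have hz : ∀ x, x ∉ Set.Ioo (-R) R → φ x = 0 := fun x hx =>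
    image_eq_zero_of_notMem_tsupport fun h => hx (hs h)
  set χ : ℝ → ℝ := fun x => ∫ t in (-R)..x, φ t with hχ
  have hd : ∀ x, HasDerivAt χ (φ x) x := fun x =>
    (hφ.continuous.integral_hasStrictDerivAt (-R) x).hasDerivAt
  have hderiv : deriv χ = φ := funext fun x => (hd x).deriv
  refine ⟨χ, ?_, ?_, hderiv⟩
  · rw [contDiff_infty_iff_deriv, hderiv]
    exact ⟨fun x => (hd x).differentiableAt, hφ⟩
  · refine HasCompactSupport.intro (isCompact_Icc (a := -R) (b := R)) fun x hx => ?_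
    rw [Set.mem_Icc, not_and_or, not_le, not_le] at hx
    rcases hx with hx | hx
    · rw [hχ]
      refine (intervalIntegral.integral_congr fun t ht => ?_).trans intervalIntegral.integral_zero
      rw [Set.uIcc_of_ge hx.le] at ht
      exact hz t fun h => by linarith [h.1, ht.2]
    · rw [← h0]
      refine intervalIntegral.integral_eq_integral_of_support_subset fun t ht => ?_
      by_contra h
      refine ht (hz t fun h' => h ⟨h'.1, h'.2.le.trans hx.le⟩)

/-- The du Bois-Reymond lemma. Subtracting from `φ` the multiple `∫ φ` of a bump `ψ` of integral one
leaves the derivative of a test function, so `v` pairs with `φ` as the constant `∫ ψ v` does. -/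
theorem ae_eq_const_of_integral_deriv_smul_eq_zero {v : ℝ → ℂ} (hv : LocallyIntegrable v volume)
    (h : ∀ φ : ℝ → ℝ, ContDiff ℝ (⊤ : ℕ∞) φ → HasCompactSupport φ → ∫ x, deriv φ x • v x = 0) :
    ∃ c : ℂ, v =ᵐ[volume] fun _ => c := by
  let b : ContDiffBump (0 : ℝ) := ⟨1, 2, one_pos, one_lt_two⟩
  set ψ : ℝ → ℝ := b.normed volume with hψ
  have hψ1 : ∫ x, ψ x = 1 := b.integral_normed
  have hψc : HasCompactSupport ψ := b.hasCompactSupport_normed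
  have hψs : ContDiff ℝ (⊤ : ℕ∞) ψ := b.contDiff_normed
  refine ⟨∫ x, ψ x • v x, ae_eq_of_integral_contDiff_smul_eq hv
    (locallyIntegrable_const _) fun φ hφ hc => ?_⟩
  have hφi : Integrable φ volume := hφ.continuous.integrable_of_hasCompactSupport hc
  have hψi : Integrable ψ volume := hψs.continuous.integrable_of_hasCompactSupport hψc
  have hsm : ContDiff ℝ (⊤ : ℕ∞) (fun x => φ x - (∫ x, φ x) * ψ x) :=
    hφ.sub (contDiff_const.mul hψs)
  have hcs : HasCompactSupport (fun x => φ x - (∫ x, φ x) * ψ x) :=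
    hc.sub hψc.mul_left
  obtain ⟨χ, hχ, hχc, hχd⟩ := exists_contDiff_primitive_of_integral_eq_zero hsm hcs (by
    rw [integral_sub hφi (hψi.const_mul _), integral_const_mul, hψ1]; ring)
  have := h χ hχ hχc
  rw [hχd] at this
  have h1 := hv.integrable_smul_of_compact_support hφ.continuous hc
  have h2 := hv.integrable_smul_of_compact_support hψs.continuous hψc
  simp only [sub_smul, mul_smul] at this
  have h3 : Integrable (fun x => (∫ x, φ x) • ψ x • v x) volume := h2.smul (∫ x, φ x)
  rw [integral_sub h1 h3, integral_smul, sub_eq_zero] at this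
  rw [this, integral_smul_const]

/-- The difference between `u` and a primitive of `g` has zero weak derivative, so it is constant.
-/
theorem HasWeakDeriv.exists_isPrimitive {u g : ℝ → ℂ} (hu : HasWeakDeriv u g) :
    ∃ w : ℝ → ℂ, u =ᵐ[volume] w ∧ IsPrimitive w g := by
  have hw := isPrimitive_integral hu.2.1 0 0
  set w : ℝ → ℂ := fun x => 0 + ∫ t in (0 : ℝ)..x, g t with hwdef
  have hwl := hw.continuous.locallyIntegrable (μ := volume)
  obtain ⟨c, hc⟩ := ae_eq_const_of_integral_deriv_smul_eq_zero (hu.1.sub hwl) fun φ hφ hφc => by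
    have hφ' := hφ.continuous_deriv (by exact_mod_cast le_top)
    have h1 := hu.1.integrable_smul_of_compact_support hφ' hφc.deriv
    have h2 := hwl.integrable_smul_of_compact_support hφ' hφc.deriv
    simp only [Pi.sub_apply, smul_sub]
    rw [integral_sub h1 h2, hu.2.2 φ hφ hφc, hw.hasWeakDeriv.2.2 φ hφ hφc, sub_self]
  refine ⟨fun x => c + ∫ t in (0 : ℝ)..x, g t, ?_, isPrimitive_integral hu.2.1 c 0⟩
  filter_upwards [hc] with x hx
  rw [← hx, Pi.sub_apply, hwdef]
  ring

/-! ### Continuous representatives of elements of `X` and the functionals on them -/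

/-- `w` is a continuous representative of an element of `X V`, with weak derivative `g`. -/
structure Admissible (V : ℝ → ℝ) (w g : ℝ → ℂ) : Prop where
  isPrimitive : IsPrimitive w g
  memLp : MemLp w 2 volume
  memLp_deriv : MemLp g 2 volume
  integrable : Integrable (fun x => V x * ‖w x‖ ^ 2) volume

theorem _root_.MeasureTheory.MemLp.integrable_norm_sq {E : Type*} [NormedAddCommGroup E]
    {w : ℝ → E} (hw : MemLp w 2 volume) : Integrable (fun x => ‖w x‖ ^ 2) volume :=
  (memLp_two_iff_integrable_sq_norm hw.1).1 hw

theorem _root_.MeasureTheory.MemLp.locallyIntegrable_of_two {w : ℝ → ℂ}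
    (hw : MemLp w 2 volume) : LocallyIntegrable w volume :=
  hw.locallyIntegrable (by norm_num)

theorem weakDeriv_congr {u w g : ℝ → ℂ} (huw : u =ᵐ[volume] w) (hw : HasWeakDeriv w g) :
    HasWeakDeriv u g := by
  refine ⟨(locallyIntegrable_congr huw).2 hw.1, hw.2.1, fun φ hφ hc => ?_⟩
  rw [← hw.2.2 φ hφ hc]
  exact integral_congr_ae (huw.mono fun x hx => by simp only [hx])

theorem exists_admissible_of_mem_X {V : ℝ → ℝ} {u : ℝ → ℂ} (hu : u ∈ X V) :
    ∃ w g, u =ᵐ[volume] w ∧ Admissible V w g := by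
  obtain ⟨⟨hu2, g, hg2, hug⟩, hi⟩ := hu
  obtain ⟨w, huw, hw⟩ := hug.exists_isPrimitive
  exact ⟨w, g, huw, hw, (memLp_congr_ae huw).1 hu2, hg2,
    hi.congr (huw.mono fun x hx => by simp only [hx])⟩

namespace Admissible

variable {V : ℝ → ℝ} {w g : ℝ → ℂ}

theorem mem_X (h : Admissible V w g) : w ∈ X V :=
  ⟨⟨h.memLp, g, h.memLp_deriv, h.isPrimitive.hasWeakDeriv⟩, h.integrable⟩

theorem weakDeriv_ae (h : Admissible V w g) {u : ℝ → ℂ} (hu : u =ᵐ[volume] w) :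
    weakDeriv u =ᵐ[volume] g :=
  (weakDeriv_congr hu h.isPrimitive.hasWeakDeriv).weakDeriv_ae_eq

theorem smul (h : Admissible V w g) (c : ℝ) :
    Admissible V (fun x => c • w x) (fun x => c • g x) := by
  refine ⟨h.isPrimitive.smul c, h.memLp.const_smul c, h.memLp_deriv.const_smul c, ?_⟩
  refine (h.integrable.const_mul (c ^ 2)).congr (.of_forall fun x => ?_)
  simp only [norm_smul, mul_pow, Real.norm_eq_abs, sq_abs]
  ring

theorem integrable_quad (h : Admissible V w g) (ω : ℝ) :
    Integrable (fun x => ‖g x‖ ^ 2 + V x * ‖w x‖ ^ 2 + ω * ‖w x‖ ^ 2) volume :=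
  (h.memLp_deriv.integrable_norm_sq.add h.integrable).add (h.memLp.integrable_norm_sq.const_mul ω)

end Admissible

/-- The quadratic form of `normXSq` for a function `w` with given derivative `g`. -/
def quad (V : ℝ → ℝ) (ω : ℝ) (w g : ℝ → ℂ) : ℝ :=
  ∫ x, (‖g x‖ ^ 2 + V x * ‖w x‖ ^ 2 + ω * ‖w x‖ ^ 2)

/-- The power `p + 1` of the norm in `L^{p+1}`. -/
def power (p : ℝ) (w : ℝ → ℂ) : ℝ := ∫ x, ‖w x‖ ^ (p + 1)

namespace Admissible

variable {V : ℝ → ℝ} {u w g : ℝ → ℂ}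

theorem quad_eq (h : Admissible V w g) (ω : ℝ) :
    quad V ω w g = (∫ x, ‖g x‖ ^ 2) + (∫ x, V x * ‖w x‖ ^ 2) + ω * ∫ x, ‖w x‖ ^ 2 := by
  have h1 : Integrable (fun x => ‖g x‖ ^ 2 + V x * ‖w x‖ ^ 2) volume :=
    h.memLp_deriv.integrable_norm_sq.add h.integrable
  rw [quad, integral_add h1 (h.memLp.integrable_norm_sq.const_mul ω),
    integral_add h.memLp_deriv.integrable_norm_sq h.integrable, integral_const_mul]

theorem integral_energy_eq (h : Admissible V w g) (hu : u =ᵐ[volume] w) :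
    ∫ x, (‖weakDeriv u x‖ ^ 2 + V x * ‖u x‖ ^ 2)
      = (∫ x, ‖g x‖ ^ 2) + ∫ x, V x * ‖w x‖ ^ 2 := by
  rw [← integral_add h.memLp_deriv.integrable_norm_sq h.integrable]
  refine integral_congr_ae ?_
  filter_upwards [hu, h.weakDeriv_ae hu] with x h1 h2
  rw [h1, h2]

theorem nehari_eq (h : Admissible V w g) (hu : u =ᵐ[volume] w) (p ω : ℝ) :
    nehari V p ω u = quad V ω w g - power p w := by
  rw [nehari, normXSq, quad, power]
  congr 1
  · refine integral_congr_ae ?_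
    filter_upwards [hu, h.weakDeriv_ae hu] with x h1 h2
    rw [h1, h2]
  · refine integral_congr_ae ?_
    filter_upwards [hu] with x h1
    rw [h1]

theorem action_eq (h : Admissible V w g) (hu : u =ᵐ[volume] w) (p ω : ℝ) :
    action V p ω u = 1 / 2 * quad V ω w g - 1 / (p + 1) * power p w := by
  have h1 : ∫ x, ‖u x‖ ^ (p + 1) = power p w :=
    integral_congr_ae (hu.mono fun x hx => by simp only [hx])
  have h2 : ∫ x, ‖u x‖ ^ 2 = ∫ x, ‖w x‖ ^ 2 :=
    integral_congr_ae (hu.mono fun x hx => by simp only [hx])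
  rw [action, energy, h.integral_energy_eq hu, h1, h2, h.quad_eq]
  ring

end Admissible

/-! ### Sobolev bounds and coercivity of the quadratic form -/

/-- Cauchy-Schwarz against the constant one, from the nonnegativity of the integral of `((b - a) f -
A)²`, where `A` is the integral of `f`. -/
theorem sq_integral_le {f : ℝ → ℝ} {a b : ℝ} (hab : a ≤ b) (hf : IntervalIntegrable f volume a b)
    (hf2 : IntervalIntegrable (fun x => f x ^ 2) volume a b) :
    (∫ x in a..b, f x) ^ 2 ≤ (b - a) * ∫ x in a..b, f x ^ 2 := by
  rcases hab.eq_or_lt with rfl | hab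
  · simp
  set A := ∫ x in a..b, f x
  have h0 : 0 ≤ ∫ x in a..b, ((b - a) * f x - A) ^ 2 :=
    intervalIntegral.integral_nonneg hab.le fun x _ => sq_nonneg _
  have h1 : ∫ x in a..b, ((b - a) * f x - A) ^ 2 =
      ∫ x in a..b, ((b - a) ^ 2 * f x ^ 2 - 2 * (b - a) * A * f x + A ^ 2) := by
    congr 1 with x; ring
  rw [h1, intervalIntegral.integral_add ((hf2.const_mul _).sub (hf.const_mul _)) (by simp),
    intervalIntegral.integral_sub (hf2.const_mul _) (hf.const_mul _),
    intervalIntegral.integral_const_mul, intervalIntegral.integral_const_mul,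
    intervalIntegral.integral_const, smul_eq_mul] at h0
  have hp : 0 < b - a := sub_pos.2 hab
  have h2 : 0 ≤ (b - a) * ((b - a) * (∫ x in a..b, f x ^ 2) - A ^ 2) := by
    have : (∫ x in a..b, f x) = A := rfl
    rw [this] at h0
    nlinarith
  nlinarith [(mul_nonneg_iff_of_pos_left hp).1 h2]

/-- Compare `w x` with `w y` for `y` in `[x, x + ε]` and average over `y`. The free `ε` makes the
derivative term as small as needed. -/
theorem Admissible.norm_sq_le {V : ℝ → ℝ} {w g : ℝ → ℂ} (h : Admissible V w g) {ε : ℝ}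
    (hε : 0 < ε) (x : ℝ) :
    ‖w x‖ ^ 2 ≤ 2 / ε * (∫ t, ‖w t‖ ^ 2) + 2 * ε * ∫ t, ‖g t‖ ^ 2 := by
  set L := ∫ t, ‖w t‖ ^ 2
  set G := ∫ t, ‖g t‖ ^ 2
  have hgi := h.memLp_deriv.integrable_norm_sq
  have hwi := h.memLp.integrable_norm_sq
  have hpt : ∀ y ∈ Set.Icc x (x + ε), ‖w x‖ ^ 2 ≤ 2 * ‖w y‖ ^ 2 + 2 * (ε * G) := by
    intro y hy
    have h1 : ‖w y - w x‖ ≤ ∫ t in x..y, ‖g t‖ := by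
      rw [h.isPrimitive.sub_eq]
      exact intervalIntegral.norm_integral_le_integral_norm hy.1
    have h2 := sq_integral_le hy.1
      (h.isPrimitive.locallyIntegrable.intervalIntegrable_real x y).norm hgi.intervalIntegrable
    have h3 : ∫ t in x..y, ‖g t‖ ^ 2 ≤ G := by
      rw [intervalIntegral.integral_of_le hy.1]
      exact setIntegral_le_integral hgi (.of_forall fun t => by positivity)
    have h4 : 0 ≤ ∫ t in x..y, ‖g t‖ ^ 2 :=
      intervalIntegral.integral_nonneg hy.1 fun t _ => by positivity
    have h5 : ‖w y - w x‖ ^ 2 ≤ ε * G := by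
      calc ‖w y - w x‖ ^ 2 ≤ (∫ t in x..y, ‖g t‖) ^ 2 := by gcongr
        _ ≤ (y - x) * ∫ t in x..y, ‖g t‖ ^ 2 := h2
        _ ≤ ε * G := mul_le_mul (by linarith [hy.2]) h3 h4 hε.le
    have h6 : ‖w x‖ ≤ ‖w y‖ + ‖w y - w x‖ := by
      have := norm_sub_le (w y) (w y - w x)
      simpa using this
    nlinarith [norm_nonneg (w x), norm_nonneg (w y), norm_nonneg (w y - w x),
      sq_nonneg (‖w y‖ - ‖w y - w x‖)]
  have hxε : x ≤ x + ε := by linarith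
  have h7 : ∫ y in x..(x + ε), ‖w x‖ ^ 2 ≤ ∫ y in x..(x + ε), (2 * ‖w y‖ ^ 2 + 2 * (ε * G)) :=
    intervalIntegral.integral_mono_on hxε (by simp)
      ((hwi.intervalIntegrable.const_mul 2).add (by simp)) hpt
  rw [intervalIntegral.integral_add (hwi.intervalIntegrable.const_mul 2) (by simp),
    intervalIntegral.integral_const_mul] at h7
  simp only [intervalIntegral.integral_const, smul_eq_mul, add_sub_cancel_left] at h7
  have h8 : ∫ t in x..(x + ε), ‖w t‖ ^ 2 ≤ L := by
    rw [intervalIntegral.integral_of_le hxε]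
    exact setIntegral_le_integral hwi (.of_forall fun t => by positivity)
  have h9 : ε * ‖w x‖ ^ 2 ≤ ε * (2 / ε * L + 2 * ε * G) := by
    have : ε * (2 / ε * L + 2 * ε * G) = 2 * L + ε * (2 * (ε * G)) := by field_simp
    rw [this]; linarith
  exact le_of_mul_le_mul_left h9 hε

theorem CondV1.lower_bound {V : ℝ → ℝ} (hV : CondV1 V) (x : ℝ) :
    -(Set.Icc (-1) 1).indicator (fun t => |V t|) x - |V 1| ≤ V x := by
  by_cases hx : x ∈ Set.Icc (-1 : ℝ) 1
  · rw [Set.indicator_of_mem hx]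
    linarith [neg_abs_le (V x), abs_nonneg (V 1)]
  · rw [Set.indicator_of_notMem hx]
    have h1 : V 1 ≤ V |x| := by
      have : 1 ≤ |x| := by
        by_contra hc
        exact hx (abs_le.1 (not_le.1 hc).le)
      exact hV.monotone (Set.mem_Ioi.2 one_pos) (Set.mem_Ioi.2 (by linarith)) this
    have h2 : V |x| = V x := by
      rcases abs_choice x with h | h <;> rw [h]
      exact hV.even x
    linarith [neg_abs_le (V 1)]

/-- The negative part of `V` is at most an integrable function supported in `[-1, 1]` plus a
constant. The integrable part is tested against the sup bound on `|w|²`, with `ε` small enough to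
cost at most half the derivative term. -/
theorem CondV1.exists_potential_bound {V : ℝ → ℝ} (hV : CondV1 V) :
    ∃ C : ℝ, ∀ w g : ℝ → ℂ, Admissible V w g →
      -(1 / 2 * ∫ x, ‖g x‖ ^ 2) - C * (∫ x, ‖w x‖ ^ 2) ≤ ∫ x, V x * ‖w x‖ ^ 2 := by
  have hAi : Integrable ((Set.Icc (-1 : ℝ) 1).indicator fun t => |V t|) volume :=
    (integrable_indicator_iff measurableSet_Icc).2
      (hV.locallyIntegrable.integrableOn_isCompact isCompact_Icc).abs
  set A := ∫ x, (Set.Icc (-1 : ℝ) 1).indicator (fun t => |V t|) x with hA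
  have hA0 : 0 ≤ A := integral_nonneg fun x => Set.indicator_nonneg (fun t _ => abs_nonneg _) x
  -- Chosen so that `A * (2 * ε) ≤ 1 / 2`; the added one covers `A = 0`.
  set ε : ℝ := 1 / (4 * (A + 1)) with hε
  have hεpos : 0 < ε := by positivity
  refine ⟨A * (2 / ε) + |V 1|, fun w g h => ?_⟩
  have hwi := h.memLp.integrable_norm_sq
  set L := ∫ t, ‖w t‖ ^ 2 with hL
  set G := ∫ t, ‖g t‖ ^ 2 with hG
  have hG0 : 0 ≤ G := integral_nonneg fun x => by positivity
  set M := 2 / ε * L + 2 * ε * G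
  have h1 : ∫ x, (-((Set.Icc (-1 : ℝ) 1).indicator (fun t => |V t|) x * M) - |V 1| * ‖w x‖ ^ 2)
      ≤ ∫ x, V x * ‖w x‖ ^ 2 := by
    refine integral_mono ((hAi.mul_const M).neg.sub (hwi.const_mul _)) h.integrable fun x => ?_
    have h2 := hV.lower_bound x
    have h3 := h.norm_sq_le hεpos x
    have h4 : 0 ≤ (Set.Icc (-1 : ℝ) 1).indicator (fun t => |V t|) x :=
      Set.indicator_nonneg (fun t _ => abs_nonneg _) x
    have h5 := mul_le_mul_of_nonneg_left h3 h4
    have h6 := mul_le_mul_of_nonneg_right h2 (sq_nonneg ‖w x‖)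
    simp only
    nlinarith
  have hneg : Integrable
      (fun x => -((Set.Icc (-1 : ℝ) 1).indicator (fun t => |V t|) x * M)) volume :=
    (hAi.mul_const M).neg
  rw [integral_sub hneg (hwi.const_mul _), integral_neg, integral_mul_const,
    integral_const_mul, ← hA] at h1
  have h7 : A * (2 * ε * G) ≤ 1 / 2 * G := by
    have : A * (2 * ε) ≤ 1 / 2 := by
      rw [hε]
      have : A * (2 * (1 / (4 * (A + 1)))) = A / (2 * (A + 1)) := by field_simp; ring
      rw [this, div_le_iff₀ (by positivity)]
      linarith
    nlinarith
  have h8 : A * M = A * (2 / ε) * L + A * (2 * ε * G) := by ring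
  nlinarith

theorem Admissible.ae_eq_zero_of_integral {V : ℝ → ℝ} {w g : ℝ → ℂ} (h : Admissible V w g)
    (h0 : ∫ x, ‖w x‖ ^ 2 = 0) : w =ᵐ[volume] 0 := by
  have := (integral_eq_zero_iff_of_nonneg (fun x => by positivity) h.memLp.integrable_norm_sq).1 h0
  filter_upwards [this] with x hx
  simpa using hx

theorem exists_spectral_gap {V : ℝ → ℝ} {ω : ℝ} (hω : omega1 V < (ω : EReal)) :
    ∃ δ : ℝ, 0 < δ ∧ ∀ w g : ℝ → ℂ, Admissible V w g →
      δ * (∫ x, ‖w x‖ ^ 2) ≤ quad V ω w g := by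
  -- A real number in between replaces `omega1 V`, whose finiteness need not be known; the gap is `ω
  -- - r`.
  obtain ⟨r, hr1, hr2⟩ := EReal.lt_iff_exists_real_btwn.1 hω
  have hr2' : r < ω := by exact_mod_cast hr2
  refine ⟨ω - r, by linarith, fun w g h => ?_⟩
  rw [h.quad_eq]
  have hL0 : 0 ≤ ∫ x, ‖w x‖ ^ 2 := integral_nonneg fun x => by positivity
  rcases hL0.eq_or_lt with hL | hL
  · have hw := h.ae_eq_zero_of_integral hL.symm
    have h1 : ∫ x, V x * ‖w x‖ ^ 2 = 0 := by
      rw [← integral_zero ℝ ℝ]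
      exact integral_congr_ae (hw.mono fun x hx => by simp [hx])
    have h2 : 0 ≤ ∫ x, ‖g x‖ ^ 2 := integral_nonneg fun x => by positivity
    rw [← hL, h1]; linarith
  · set L := ∫ x, ‖w x‖ ^ 2 with hLdef
    set c : ℝ := (√L)⁻¹ with hc
    have hc2 : c ^ 2 = L⁻¹ := by rw [hc, inv_pow, Real.sq_sqrt hL0]
    have hs := h.smul c
    have hnorm : ∀ z : ℂ, ‖c • z‖ ^ 2 = L⁻¹ * ‖z‖ ^ 2 := fun z => by
      rw [norm_smul, mul_pow, Real.norm_eq_abs, sq_abs, hc2]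
    have h1 : ∫ x, ‖c • w x‖ ^ 2 = 1 := by
      simp only [hnorm]
      rw [integral_const_mul, ← hLdef, inv_mul_cancel₀ hL.ne']
    have hle : -omega1 V ≤ (((∫ x, ‖c • g x‖ ^ 2) + ∫ x, V x * ‖c • w x‖ ^ 2 : ℝ) : EReal) := by
      rw [omega1, neg_neg, ← hs.integral_energy_eq Filter.EventuallyEq.rfl]
      exact iInf₂_le (fun x => c • w x) ⟨hs.mem_X, h1⟩
    have h2 : ((-r : ℝ) : EReal) ≤ -omega1 V := by
      rw [EReal.coe_neg]; exact EReal.neg_le_neg_iff.2 hr1.le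
    have h3 : -r ≤ (∫ x, ‖c • g x‖ ^ 2) + ∫ x, V x * ‖c • w x‖ ^ 2 := by
      exact_mod_cast h2.trans hle
    have h4 : ∀ x, V x * ‖c • w x‖ ^ 2 = L⁻¹ * (V x * ‖w x‖ ^ 2) := fun x => by
      rw [hnorm]; ring
    simp only [h4] at h3
    simp only [hnorm] at h3
    rw [integral_const_mul, integral_const_mul, ← mul_add] at h3
    have h5 := mul_le_mul_of_nonneg_left h3 hL0
    rw [← mul_assoc, mul_inv_cancel₀ hL.ne', one_mul] at h5
    linarith

/-- The spectral gap controls the `L²` norm; the potential bound then controls the derivative, and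
the sup bound with `ε = 1` controls the values. -/
theorem CondV1.exists_coercive {V : ℝ → ℝ} {ω : ℝ} (hV : CondV1 V)
    (hω : omega1 V < (ω : EReal)) :
    ∃ K : ℝ, 0 < K ∧ ∀ w g : ℝ → ℂ, Admissible V w g →
      (∫ x, ‖w x‖ ^ 2) ≤ K * quad V ω w g ∧ ∀ x, ‖w x‖ ^ 2 ≤ K * quad V ω w g := by
  obtain ⟨C, hC⟩ := hV.exists_potential_bound
  obtain ⟨δ, hδ, hgap⟩ := exists_spectral_gap hω
  set D := |C - ω| with hD
  have hD0 : 0 ≤ D := abs_nonneg _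
  have hK : 0 < 2 / δ + 4 * (1 + D / δ) := by positivity
  refine ⟨2 / δ + 4 * (1 + D / δ), hK, fun w g h => ?_⟩
  have h1 := hC w g h
  have h2 := hgap w g h
  have h3 := h.quad_eq ω
  set L := ∫ x, ‖w x‖ ^ 2 with hL
  set G := ∫ x, ‖g x‖ ^ 2 with hG
  set N := quad V ω w g
  have hL0 : 0 ≤ L := integral_nonneg fun x => by positivity
  have hN0 : 0 ≤ N := (by positivity : 0 ≤ δ * L).trans h2
  have h4 : L ≤ N / δ := by rw [le_div_iff₀ hδ]; linarith
  have h5 : G ≤ 2 * (1 + D / δ) * N := by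
    have h6 : (C - ω) * L ≤ D * L := mul_le_mul_of_nonneg_right (le_abs_self _) hL0
    have h7 : D * L ≤ D * (N / δ) := mul_le_mul_of_nonneg_left h4 hD0
    have h8 : 2 * (1 + D / δ) * N = 2 * (N + D * (N / δ)) := by ring
    rw [h8]; nlinarith
  have h9 : 2 * L + 2 * G ≤ (2 / δ + 4 * (1 + D / δ)) * N := by
    have : (2 / δ + 4 * (1 + D / δ)) * N = 2 * (N / δ) + 2 * (2 * (1 + D / δ) * N) := by ring
    rw [this]; linarith
  have hG0 : 0 ≤ G := integral_nonneg fun x => by positivity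
  refine ⟨by linarith, fun x => ?_⟩
  have := h.norm_sq_le one_pos x
  rw [← hL, ← hG] at this
  linarith

theorem Admissible.norm_bounded {V : ℝ → ℝ} {w g : ℝ → ℂ} (h : Admissible V w g) :
    ∃ M : ℝ, 0 < M ∧ ∀ x, ‖w x‖ ≤ M := by
  refine ⟨√(2 / 1 * (∫ t, ‖w t‖ ^ 2) + 2 * 1 * ∫ t, ‖g t‖ ^ 2) + 1, by positivity, fun x => ?_⟩
  have := Real.le_sqrt_of_sq_le (h.norm_sq_le one_pos x)
  linarith

theorem rpow_add_one_le {p a M : ℝ} (hp : 1 < p) (ha : 0 ≤ a) (haM : a ≤ M) :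
    a ^ (p + 1) ≤ M ^ (p - 1) * a ^ 2 := by
  have h1 : a ^ (p + 1) = a ^ (p - 1) * a ^ 2 := by
    rw [← Real.rpow_two, ← Real.rpow_add_of_nonneg ha (by linarith) (by norm_num)]
    congr 1; ring
  rw [h1]
  gcongr

theorem Admissible.integrable_power {V : ℝ → ℝ} {w g : ℝ → ℂ} (h : Admissible V w g) {p : ℝ}
    (hp : 1 < p) : Integrable (fun x => ‖w x‖ ^ (p + 1)) volume := by
  obtain ⟨M, hM, hwM⟩ := h.norm_bounded
  refine (h.memLp.integrable_norm_sq.const_mul (M ^ (p - 1))).mono'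
    (h.isPrimitive.continuous.norm.rpow_const fun x => Or.inr (by linarith)).aestronglyMeasurable
    (.of_forall fun x => ?_)
  rw [Real.norm_of_nonneg (by positivity)]
  exact rpow_add_one_le hp (norm_nonneg _) (hwM x)

/-- Bound `|w|^(p-1)` by its supremum and integrate the remaining `|w|²`. This keeps the Nehari set
away from zero in `dLevel_pos`. -/
theorem CondV1.exists_power_bound {V : ℝ → ℝ} {p ω : ℝ} (hV : CondV1 V) (hp : 1 < p)
    (hω : omega1 V < (ω : EReal)) :
    ∃ K : ℝ, 0 < K ∧ ∀ w g : ℝ → ℂ, Admissible V w g →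
      power p w ≤ K * quad V ω w g ^ ((p + 1) / 2) := by
  obtain ⟨K, hK, hb⟩ := hV.exists_coercive hω
  refine ⟨K ^ ((p + 1) / 2), by positivity, fun w g h => ?_⟩
  obtain ⟨h1, h2⟩ := hb w g h
  set N := quad V ω w g
  have hKN : 0 ≤ K * N := (sq_nonneg ‖w 0‖).trans (h2 0)
  have hN : 0 ≤ N := nonneg_of_mul_nonneg_right hKN hK
  set M := √(K * N)
  have hM0 : 0 ≤ M := Real.sqrt_nonneg _
  have h3 : ∀ x, ‖w x‖ ≤ M := fun x => Real.le_sqrt_of_sq_le (h2 x)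
  calc power p w ≤ ∫ x, M ^ (p - 1) * ‖w x‖ ^ 2 :=
        integral_mono (h.integrable_power hp) (h.memLp.integrable_norm_sq.const_mul _)
          fun x => rpow_add_one_le hp (norm_nonneg _) (h3 x)
    _ = M ^ (p - 1) * ∫ x, ‖w x‖ ^ 2 := integral_const_mul _ _
    _ ≤ M ^ (p - 1) * (K * N) := by gcongr
    _ = K ^ ((p + 1) / 2) * N ^ ((p + 1) / 2) := by
        rw [← Real.mul_rpow hK.le hN]
        have : M ^ (p - 1) = (K * N) ^ ((p - 1) / 2) := by
          rw [show M = (K * N) ^ (1 / 2 : ℝ) from Real.sqrt_eq_rpow _, ← Real.rpow_mul hKN]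
          congr 1; ring
        rw [this, ← Real.rpow_add_one' hKN (by linarith)]
        congr 1; ring

/-! ### First variation and the Euler-Lagrange equation -/

namespace Admissible

variable {V : ℝ → ℝ} {u g h k : ℝ → ℂ}

theorem add (hV : AEStronglyMeasurable V volume) (hu : Admissible V u g) (hh : Admissible V h k) :
    Admissible V (fun x => u x + h x) (fun x => g x + k x) := by
  refine ⟨hu.isPrimitive.add hh.isPrimitive, hu.memLp.add hh.memLp,
    hu.memLp_deriv.add hh.memLp_deriv, ?_⟩
  refine ((hu.integrable.norm.const_mul 2).add (hh.integrable.norm.const_mul 2)).mono'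
    (hV.mul ((hu.isPrimitive.continuous.add
      hh.isPrimitive.continuous).norm.pow 2).aestronglyMeasurable) (.of_forall fun x => ?_)
  simp only [Pi.add_apply, norm_mul, norm_pow, norm_norm]
  have h1 : ‖u x + h x‖ ^ 2 ≤ 2 * ‖u x‖ ^ 2 + 2 * ‖h x‖ ^ 2 := by
    nlinarith [norm_add_le (u x) (h x), norm_nonneg (u x + h x), norm_nonneg (u x),
      norm_nonneg (h x), sq_nonneg (‖u x‖ - ‖h x‖)]
  nlinarith [mul_le_mul_of_nonneg_left h1 (norm_nonneg (V x))]

end Admissible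

/-- The density of the bilinear form associated with `quad`. -/
def bilinDensity (V : ℝ → ℝ) (ω : ℝ) (u g h k : ℝ → ℂ) (x : ℝ) : ℝ :=
  inner ℝ (g x) (k x) + V x * inner ℝ (u x) (h x) + ω * inner ℝ (u x) (h x)

namespace Admissible

variable {V : ℝ → ℝ} {u g h k : ℝ → ℂ}

theorem integrable_bilinDensity (hV : AEStronglyMeasurable V volume) (hu : Admissible V u g)
    (hh : Admissible V h k) (ω : ℝ) : Integrable (bilinDensity V ω u g h k) volume := by
  refine ((((hu.add hV hh).integrable_quad ω).sub (hu.integrable_quad ω)).sub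
    (hh.integrable_quad ω)).const_mul (1 / 2) |>.congr (.of_forall fun x => ?_)
  simp only [Pi.sub_apply, norm_add_sq_real, bilinDensity]
  ring

theorem quad_add_smul (hV : AEStronglyMeasurable V volume) (hu : Admissible V u g)
    (hh : Admissible V h k) (ω t : ℝ) :
    quad V ω (fun x => u x + t • h x) (fun x => g x + t • k x) =
      quad V ω u g + t * (2 * ∫ x, bilinDensity V ω u g h k x) + t ^ 2 * quad V ω h k := by
  have hb := hu.integrable_bilinDensity hV hh ω
  have h1 := hu.integrable_quad ω
  have h2 := (hb.const_mul 2).const_mul t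
  have h3 := (hh.integrable_quad ω).const_mul (t ^ 2)
  have e : ∀ x, ‖g x + t • k x‖ ^ 2 + V x * ‖u x + t • h x‖ ^ 2 + ω * ‖u x + t • h x‖ ^ 2 =
      (‖g x‖ ^ 2 + V x * ‖u x‖ ^ 2 + ω * ‖u x‖ ^ 2) + t * (2 * bilinDensity V ω u g h k x) +
        t ^ 2 * (‖k x‖ ^ 2 + V x * ‖h x‖ ^ 2 + ω * ‖h x‖ ^ 2) := fun x => by
    simp only [norm_add_sq_real, bilinDensity, norm_smul, inner_smul_right, mul_pow,
      Real.norm_eq_abs, sq_abs]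
    ring
  have h12 : Integrable (fun x => (‖g x‖ ^ 2 + V x * ‖u x‖ ^ 2 + ω * ‖u x‖ ^ 2) +
      t * (2 * bilinDensity V ω u g h k x)) volume := h1.add h2
  rw [quad]
  simp only [e]
  rw [integral_add h12 h3, integral_add h1 h2, integral_const_mul, integral_const_mul,
    integral_const_mul]
  rfl

theorem hasDerivAt_power (hu : Admissible V u g) (hh : Admissible V h k) {p : ℝ} (hp : 1 < p) :
    HasDerivAt (fun t : ℝ => power p (fun x => u x + t • h x))
      ((p + 1) * ∫ x, ‖u x‖ ^ (p - 1) * inner ℝ (u x) (h x)) 0 := by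
  obtain ⟨M, hM, huM⟩ := hu.norm_bounded
  obtain ⟨H, hH, hhH⟩ := hh.norm_bounded
  have huc := hu.isPrimitive.continuous
  have hhc := hh.isPrimitive.continuous
  have key := hasDerivAt_integral_of_dominated_loc_of_deriv_le (μ := (volume : Measure ℝ))
    (F := fun (t : ℝ) x => ‖u x + t • h x‖ ^ (p + 1))
    (F' := fun t x => (p + 1) * ‖u x + t • h x‖ ^ (p - 1) * inner ℝ (u x + t • h x) (h x))
    -- For `|t| < 1` the norm of `u + t h` is at most `M + H`, and its inner product with `h` is at
    -- most `|u|² + 2 |h|²` in absolute value.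
    (bound := fun x => (p + 1) * (M + H) ^ (p - 1) * (‖u x‖ ^ 2 + 2 * ‖h x‖ ^ 2))
    (x₀ := 0) (s := Metric.ball 0 1) (Metric.ball_mem_nhds 0 one_pos)
    (.of_forall fun t => ((huc.add (hhc.const_smul t)).norm.rpow_const
      fun x => Or.inr (by linarith)).aestronglyMeasurable)
    (by simpa using hu.integrable_power hp)
    (by
      refine Continuous.aestronglyMeasurable ?_
      have hc : Continuous fun x => u x + (0 : ℝ) • h x := by fun_prop
      exact (continuous_const.mul (hc.norm.rpow_const fun x => Or.inr (by linarith))).mul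
        (hc.inner hhc))
    (.of_forall fun x t ht => by
      have ht1 : |t| ≤ 1 := by simpa using (mem_ball_zero_iff.1 ht).le
      have h1 : ‖u x + t • h x‖ ≤ ‖u x‖ + ‖h x‖ := by
        refine (norm_add_le _ _).trans ?_
        rw [norm_smul, Real.norm_eq_abs]
        nlinarith [norm_nonneg (h x)]
      have h2 : ‖u x + t • h x‖ ≤ M + H := h1.trans (add_le_add (huM x) (hhH x))
      have h3 : |inner ℝ (u x + t • h x) (h x)| ≤ ‖u x‖ ^ 2 + 2 * ‖h x‖ ^ 2 := by
        refine (abs_real_inner_le_norm _ _).trans ?_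
        nlinarith [mul_le_mul_of_nonneg_right h1 (norm_nonneg (h x)),
          sq_nonneg (‖u x‖ - ‖h x‖), sq_nonneg (‖u x‖), sq_nonneg (‖h x‖)]
      rw [Real.norm_eq_abs, abs_mul, abs_of_nonneg (by positivity)]
      gcongr)
    ((hu.memLp.integrable_norm_sq.add (hh.memLp.integrable_norm_sq.const_mul 2)).const_mul _)
    (.of_forall fun x t _ => by
      have h1 : HasDerivAt (fun t : ℝ => u x + t • h x) (h x) t := by
        simpa using ((hasDerivAt_id t).smul_const (h x)).const_add (u x)
      have h2 := (hasFDerivAt_norm_rpow (u x + t • h x)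
        (by linarith : 1 < p + 1)).comp_hasDerivAt t h1
      rw [show p + 1 - 2 = p - 1 by ring] at h2
      exact h2)
  have h3 := key.2
  simp only [zero_smul, add_zero, mul_assoc] at h3
  rwa [integral_const_mul] at h3

end Admissible

/-- A nonzero solution of the Nehari constraint which minimises the scale-invariant quotient
`quad ^ ((p + 1) / 2) / power`. -/
structure Optimal (V : ℝ → ℝ) (p ω : ℝ) (u g : ℝ → ℂ) : Prop where
  admissible : Admissible V u g
  power_pos : 0 < power p u
  quad_eq : quad V ω u g = power p u
  le : ∀ w h : ℝ → ℂ, Admissible V w h →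
    power p u ^ ((p - 1) / 2) * power p w ≤ quad V ω w h ^ ((p + 1) / 2)

/-- Along `u + t h` the difference of the two sides of `Optimal.le` is nonnegative and vanishes at
`t = 0`, so its derivative there is zero. That derivative is a positive multiple of `B - D`; no
Lagrange multiplier arises. -/
theorem Optimal.euler_lagrange {V : ℝ → ℝ} {p ω : ℝ} {u g h k : ℝ → ℂ}
    (hV : AEStronglyMeasurable V volume) (hp : 1 < p) (hu : Optimal V p ω u g)
    (hh : Admissible V h k) :
    ∫ x, bilinDensity V ω u g h k x = ∫ x, ‖u x‖ ^ (p - 1) * inner ℝ (u x) (h x) := by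
  set B := ∫ x, bilinDensity V ω u g h k x with hB
  set D := ∫ x, ‖u x‖ ^ (p - 1) * inner ℝ (u x) (h x) with hD
  set n := power p u with hn
  have hn0 : 0 < n := hu.power_pos
  let N : ℝ → ℝ := fun t => n + t * (2 * B) + t ^ 2 * quad V ω h k
  have hN : ∀ t : ℝ, quad V ω (fun x => u x + t • h x) (fun x => g x + t • k x) = N t := fun t => by
    rw [hu.admissible.quad_add_smul hV hh, hu.quad_eq]
  have hN0 : N 0 = n := by simp [N]
  have hNd : HasDerivAt N (2 * B) 0 := by
    have h1 := ((hasDerivAt_id (0 : ℝ)).mul_const (2 * B)).const_add n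
    have h2 := ((hasDerivAt_id (0 : ℝ)).pow 2).mul_const (quad V ω h k)
    have h3 := h1.add h2
    simp only [one_mul, Nat.cast_ofNat, id_eq, mul_zero, zero_mul, add_zero, pow_one,
      Nat.add_one_sub_one] at h3
    exact h3
  have hNq := hNd.rpow_const (p := (p + 1) / 2) (Or.inl (by rw [hN0]; exact hn0.ne'))
  have hPd := (hu.admissible.hasDerivAt_power hh hp).const_mul (n ^ ((p - 1) / 2))
  have hfd := hNq.sub hPd
  have hP0 : power p (fun x => u x + (0 : ℝ) • h x) = n := by simp [hn]
  have hq : n ^ ((p + 1) / 2) = n ^ ((p - 1) / 2) * n := by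
    rw [← Real.rpow_add_one hn0.ne']; congr 1; ring
  have hmin : IsLocalMin ((fun t => N t ^ ((p + 1) / 2)) -
      fun t : ℝ => n ^ ((p - 1) / 2) * power p (fun x => u x + t • h x)) 0 := by
    refine .of_forall fun t => ?_
    simp only [Pi.sub_apply]
    rw [hP0, hN0, hq, sub_self, ← hN]
    exact sub_nonneg.2 (hu.le _ _ (hu.admissible.add hV (hh.smul t)))
  have h0 := hmin.hasDerivAt_eq_zero hfd
  rw [hN0, show (p + 1) / 2 - 1 = (p - 1) / 2 by ring, ← hD] at h0
  have hpos : 0 < n ^ ((p - 1) / 2) * (p + 1) := by positivity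
  have : n ^ ((p - 1) / 2) * (p + 1) * (B - D) = 0 := by linear_combination h0
  have := (mul_eq_zero.1 this).resolve_left hpos.ne'
  linarith

theorem admissible_test {V : ℝ → ℝ} (hV : LocallyIntegrable V volume) {φ : ℝ → ℝ}
    (hφ : ContDiff ℝ (⊤ : ℕ∞) φ) (hc : HasCompactSupport φ) (z : ℂ) :
    Admissible V (fun x => φ x • z) (fun x => deriv φ x • z) := by
  have hφ' : Continuous (deriv φ) := hφ.continuous_deriv (by exact_mod_cast le_top)
  have hc1 : Continuous fun x => φ x • z := hφ.continuous.smul continuous_const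
  have hc2 : Continuous fun x => deriv φ x • z := hφ'.smul continuous_const
  have hd : ∀ x, HasDerivAt (fun x => φ x • z) (deriv φ x • z) x := fun x =>
    ((hφ.differentiable (by simp) x).hasDerivAt).smul_const z
  refine ⟨⟨hc2.locallyIntegrable, fun x y => ?_⟩,
    hc1.memLp_of_hasCompactSupport hc.smul_right,
    hc2.memLp_of_hasCompactSupport hc.deriv.smul_right, ?_⟩
  · exact (intervalIntegral.integral_eq_sub_of_hasDerivAt (fun t _ => hd t)
      (hc2.intervalIntegrable x y)).symm
  · have h1 : HasCompactSupport fun x => ‖φ x • z‖ ^ 2 :=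
      (hc.smul_right (f' := fun _ => z)).comp_left (g := fun w : ℂ => ‖w‖ ^ 2) (by simp)
    have h2 := hV.integrable_smul_left_of_hasCompactSupport (hc1.norm.pow 2) h1
    exact h2.congr (.of_forall fun x => by
      simp only [smul_eq_mul, Pi.pow_apply]; ring)

theorem locallyIntegrable_potential {V : ℝ → ℝ} {p ω : ℝ} {u : ℝ → ℂ}
    (hV : LocallyIntegrable V volume) (hu : Continuous u) (hp : 1 < p) :
    LocallyIntegrable (fun x => V x + ω - ‖u x‖ ^ (p - 1)) volume :=
  (hV.add (locallyIntegrable_const ω)).sub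
    (hu.norm.rpow_const fun x => Or.inr (by linarith)).locallyIntegrable

theorem locallyIntegrable_potential_smul {V : ℝ → ℝ} {p ω : ℝ} {u : ℝ → ℂ}
    (hV : LocallyIntegrable V volume) (hu : Continuous u) (hp : 1 < p) :
    LocallyIntegrable (fun x => (V x + ω - ‖u x‖ ^ (p - 1)) • u x) volume := by
  have h1 := locallyIntegrable_potential (ω := ω) hV hu hp
  rw [locallyIntegrable_iff]
  intro K hK
  exact (h1.integrableOn_isCompact hK).smul_continuousOn hu.continuousOn hK

theorem Optimal.hasWeakDeriv_deriv {V : ℝ → ℝ} {p ω : ℝ} {u g : ℝ → ℂ}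
    (hV : LocallyIntegrable V volume) (hp : 1 < p) (hu : Optimal V p ω u g) :
    HasWeakDeriv g (fun x => (V x + ω - ‖u x‖ ^ (p - 1)) • u x) := by
  have hq := locallyIntegrable_potential_smul (ω := ω) hV hu.admissible.isPrimitive.continuous hp
  have hg := hu.admissible.isPrimitive.locallyIntegrable
  refine ⟨hg, hq, fun φ hφ hc => ?_⟩
  have hφ' : Continuous (deriv φ) := hφ.continuous_deriv (by exact_mod_cast le_top)
  have hi1 := hg.integrable_smul_of_compact_support hφ' hc.deriv
  have hi2 := hq.integrable_smul_of_compact_support hφ.continuous hc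
  -- Pairing with every `z` turns the complex identity into the real Euler-Lagrange identity in the
  -- direction `φ z`.
  refine ext_inner_left ℝ fun z => ?_
  have hEL := hu.euler_lagrange hV.aestronglyMeasurable hp (admissible_test hV hφ hc z)
  have hb := hu.admissible.integrable_bilinDensity hV.aestronglyMeasurable
    (admissible_test hV hφ hc z) ω
  have e : ∀ x, bilinDensity V ω u g (fun x => φ x • z) (fun x => deriv φ x • z) x =
      inner ℝ z (deriv φ x • g x) + (inner ℝ z (φ x • (V x + ω - ‖u x‖ ^ (p - 1)) • u x) +
      ‖u x‖ ^ (p - 1) * inner ℝ (u x) (φ x • z)) := fun x => by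
    simp only [bilinDensity, inner_smul_right, real_inner_comm z]
    ring
  have hi3 : Integrable (fun x => inner ℝ z (deriv φ x • g x)) volume := hi1.const_inner z
  have hi4 : Integrable (fun x => inner ℝ z (φ x • (V x + ω - ‖u x‖ ^ (p - 1)) • u x)) volume :=
    hi2.const_inner z
  have hi5 : Integrable (fun x => ‖u x‖ ^ (p - 1) * inner ℝ (u x) (φ x • z)) volume := by
    refine ((hb.sub hi3).sub hi4).congr (.of_forall fun x => ?_)
    simp only [Pi.sub_apply, e]
    ring
  simp only [e] at hEL
  have hi45 : Integrable (fun x => inner ℝ z (φ x • (V x + ω - ‖u x‖ ^ (p - 1)) • u x) +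
      ‖u x‖ ^ (p - 1) * inner ℝ (u x) (φ x • z)) volume := hi4.add hi5
  rw [integral_add hi3 hi45, integral_add hi4 hi5, integral_inner hi1,
    integral_inner hi2] at hEL
  rw [inner_neg_right]
  linarith

/-! ### From minimisers on the Nehari set to optimal functions -/

theorem power_nonneg (p : ℝ) (w : ℝ → ℂ) : 0 ≤ power p w :=
  integral_nonneg fun x => by positivity

theorem power_smul (p : ℝ) {c : ℝ} (hc : 0 ≤ c) (w : ℝ → ℂ) :
    power p (fun x => c • w x) = c ^ (p + 1) * power p w := by
  rw [power, power, ← integral_const_mul]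
  congr 1 with x
  rw [norm_smul, Real.norm_of_nonneg hc, Real.mul_rpow hc (norm_nonneg _)]

theorem quad_smul (V : ℝ → ℝ) (ω c : ℝ) (w g : ℝ → ℂ) :
    quad V ω (fun x => c • w x) (fun x => c • g x) = c ^ 2 * quad V ω w g := by
  rw [quad, quad, ← integral_const_mul]
  congr 1 with x
  simp only [norm_smul, mul_pow, Real.norm_eq_abs, sq_abs]
  ring

theorem Admissible.power_pos {V : ℝ → ℝ} {w g : ℝ → ℂ} (h : Admissible V w g) {p : ℝ}
    (hp : 1 < p) (hw : ¬ w =ᵐ[volume] 0) : 0 < power p w := by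
  refine (power_nonneg p w).lt_of_ne fun h0 => hw ?_
  have := (integral_eq_zero_iff_of_nonneg (fun x => by positivity) (h.integrable_power hp)).1 h0.symm
  filter_upwards [this] with x hx
  have h1 : ‖w x‖ ^ (p + 1) = 0 := hx
  rw [Real.rpow_eq_zero (norm_nonneg _) (by linarith)] at h1
  simpa using h1

theorem Admissible.quad_pos {V : ℝ → ℝ} {ω : ℝ} (hω : omega1 V < (ω : EReal)) {w g : ℝ → ℂ}
    (h : Admissible V w g) (hw : ¬ w =ᵐ[volume] 0) : 0 < quad V ω w g := by
  obtain ⟨δ, hδ, hgap⟩ := exists_spectral_gap hω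
  have hL : 0 < ∫ x, ‖w x‖ ^ 2 :=
    (integral_nonneg fun x => by positivity).lt_of_ne fun h0 => hw (h.ae_eq_zero_of_integral h0.symm)
  exact (mul_pos hδ hL).trans_le (hgap w g h)

theorem Admissible.quad_nonneg {V : ℝ → ℝ} {ω : ℝ} (hω : omega1 V < (ω : EReal)) {w g : ℝ → ℂ}
    (h : Admissible V w g) : 0 ≤ quad V ω w g := by
  obtain ⟨δ, hδ, hgap⟩ := exists_spectral_gap hω
  have hL : 0 ≤ ∫ x, ‖w x‖ ^ 2 := integral_nonneg fun x => by positivity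
  exact (mul_nonneg hδ.le hL).trans (hgap w g h)

theorem Admissible.action_eq_of_quad_eq {V : ℝ → ℝ} {p ω : ℝ} {u w g : ℝ → ℂ}
    (h : Admissible V w g) (hu : u =ᵐ[volume] w) (hq : quad V ω w g = power p w) :
    action V p ω u = (1 / 2 - 1 / (p + 1)) * quad V ω w g := by
  rw [h.action_eq hu p ω, ← hq]; ring

theorem nehari_constant_pos {p : ℝ} (hp : 1 < p) : 0 < 1 / 2 - 1 / (p + 1) := by
  rw [sub_pos]
  exact one_div_lt_one_div_of_lt (by norm_num) (by linarith)

/-- The level `d(ω)` is positive. -/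
theorem dLevel_pos {V : ℝ → ℝ} {p ω : ℝ} (hV : CondV1 V) (hp : 1 < p)
    (hω : omega1 V < (ω : EReal)) : 0 < dLevel V p ω := by
  obtain ⟨K, hK, hb⟩ := hV.exists_power_bound hp hω
  -- On the Nehari set `N ≤ K * N ^ ((p + 1) / 2)` with `N > 0`, which says `η ≤ N`.
  set η : ℝ := (1 / K) ^ (2 / (p - 1)) with hη
  have hη0 : 0 < η := by positivity
  have hκ := nehari_constant_pos hp
  have hle : (((1 / 2 - 1 / (p + 1)) * η : ℝ) : EReal) ≤ dLevel V p ω := by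
    refine le_iInf₂ fun u hu => ?_
    obtain ⟨huX, hu0, huK⟩ := hu
    obtain ⟨w, g, huw, h⟩ := exists_admissible_of_mem_X huX
    have hw0 : ¬ w =ᵐ[volume] 0 := fun h0 => hu0 (huw.trans h0)
    have hq : quad V ω w g = power p w := by
      rw [h.nehari_eq huw] at huK; linarith
    have hN := h.quad_pos hω hw0
    have h1 := hb w g h
    rw [← hq] at h1
    set N := quad V ω w g
    have h2 : N ^ ((p + 1) / 2) = N * N ^ ((p - 1) / 2) := by
      rw [← Real.rpow_one_add' hN.le (by linarith)]; congr 1; ring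
    have h3 : 1 / K ≤ N ^ ((p - 1) / 2) := by
      rw [div_le_iff₀ hK]
      rw [h2] at h1
      have : N * 1 ≤ N * (N ^ ((p - 1) / 2) * K) := by linarith
      exact le_of_mul_le_mul_left this hN
    have h4 : η ≤ N := by
      have h5 : η ≤ (N ^ ((p - 1) / 2)) ^ (2 / (p - 1)) := by
        have : 0 ≤ 2 / (p - 1) := div_nonneg (by norm_num) (by linarith)
        exact Real.rpow_le_rpow (by positivity) h3 this
      have hp1 : p - 1 ≠ 0 := by linarith
      rwa [← Real.rpow_mul hN.le, show (p - 1) / 2 * (2 / (p - 1)) = 1 by field_simp,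
        Real.rpow_one] at h5
    rw [h.action_eq_of_quad_eq huw hq, EReal.coe_le_coe_iff]
    exact mul_le_mul_of_nonneg_left h4 hκ.le
  refine lt_of_lt_of_le ?_ hle
  exact_mod_cast mul_pos hκ hη0

/-- Scale a competitor onto the Nehari set, compare the quadratic forms there, and rewrite the
result in terms of the unscaled competitor. -/
theorem exists_optimal_of_mem_minimizers {V : ℝ → ℝ} {p ω : ℝ} (hV : CondV1 V) (hp : 1 < p)
    (hω : omega1 V < (ω : EReal)) {u : ℝ → ℂ} (hu : u ∈ minimizers V p ω) :
    ∃ w g, u =ᵐ[volume] w ∧ Optimal V p ω w g := by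
  obtain ⟨huX, huK, hd⟩ := hu
  obtain ⟨w, g, huw, h⟩ := exists_admissible_of_mem_X huX
  have hq : quad V ω w g = power p w := by
    rw [h.nehari_eq huw] at huK; linarith
  have hκ := nehari_constant_pos hp
  have hN : 0 < quad V ω w g := by
    -- Membership in `minimizers` does not by itself exclude the zero function; the positive level
    -- does.
    have h1 := dLevel_pos hV hp hω
    rw [← hd, h.action_eq_of_quad_eq huw hq] at h1
    have h2 : 0 < (1 / 2 - 1 / (p + 1)) * quad V ω w g := by exact_mod_cast h1
    exact (mul_pos_iff_of_pos_left hκ).1 h2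
  refine ⟨w, g, huw, h, hq ▸ hN, hq, fun f k hf => ?_⟩
  rw [← hq]
  set n := quad V ω w g with hn
  by_cases hf0 : f =ᵐ[volume] 0
  · have : power p f = 0 := by
      rw [power, ← integral_zero ℝ ℝ]
      refine integral_congr_ae (hf0.mono fun x hx => ?_)
      simp only [hx, Pi.zero_apply, norm_zero]
      exact Real.zero_rpow (by linarith)
    rw [this, mul_zero]
    exact Real.rpow_nonneg (hf.quad_nonneg hω) _
  have hP := hf.power_pos hp hf0
  have hNf := hf.quad_pos hω hf0
  set N := quad V ω f k with hNdef
  set P := power p f with hPdef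
  have hNP : 0 < N / P := div_pos hNf hP
  have hp1 : p - 1 ≠ 0 := by linarith
  -- The solution of `c ^ 2 * N = c ^ (p + 1) * P`, the Nehari condition for `c f`.
  set c : ℝ := (N / P) ^ (1 / (p - 1)) with hc
  have hc0 : 0 < c := Real.rpow_pos_of_pos hNP _
  have hcp : c ^ (p - 1) = N / P := by
    rw [hc, ← Real.rpow_mul hNP.le, one_div_mul_cancel hp1, Real.rpow_one]
  have hs := hf.smul c
  have hsq : quad V ω (fun x => c • f x) (fun x => c • k x) = power p (fun x => c • f x) := by
    rw [quad_smul, power_smul p hc0.le, show p + 1 = (p - 1) + 2 by ring,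
      Real.rpow_add hc0, hcp, Real.rpow_two, ← hNdef, ← hPdef]
    field_simp
  have hs0 : ¬ (fun x => c • f x) =ᵐ[volume] 0 := fun h0 => hf0 <| by
    filter_upwards [h0] with x hx
    simpa [hc0.ne'] using hx
  have hle : (action V p ω u : EReal) ≤ action V p ω (fun x => c • f x) := by
    rw [hd]
    refine iInf₂_le (fun x => c • f x) ⟨hs.mem_X, hs0, ?_⟩
    rw [hs.nehari_eq Filter.EventuallyEq.rfl, hsq, sub_self]
  rw [EReal.coe_le_coe_iff, h.action_eq_of_quad_eq huw hq,
    hs.action_eq_of_quad_eq Filter.EventuallyEq.rfl hsq, quad_smul] at hle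
  have h1 : n ≤ c ^ 2 * N := le_of_mul_le_mul_left hle hκ
  have h2 : n ^ ((p - 1) / 2) ≤ (c ^ 2 * N) ^ ((p - 1) / 2) :=
    Real.rpow_le_rpow hN.le h1 (by linarith)
  have h3 : (c ^ 2) ^ ((p - 1) / 2) = N / P := by
    rw [← hcp, ← Real.rpow_two, ← Real.rpow_mul hc0.le]
    congr 1; ring
  rw [Real.mul_rpow (sq_nonneg c) hNf.le, h3] at h2
  calc n ^ ((p - 1) / 2) * P ≤ N / P * N ^ ((p - 1) / 2) * P := by gcongr
    _ = N ^ ((p - 1) / 2) * N := by field_simp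
    _ = N ^ ((p + 1) / 2) := by rw [← Real.rpow_add_one hNf.ne']; congr 1; ring

/-! ### Cutting and reflecting -/

/-- The function equal to `u` on `(-∞, a]` and to `T ∘ u` on `(a, ∞)`. -/
def flip (T : ℂ → ℂ) (a : ℝ) (u : ℝ → ℂ) (x : ℝ) : ℂ := if x ≤ a then u x else T (u x)

theorem norm_flip (T : ℂ ≃ₗᵢ[ℝ] ℂ) (a : ℝ) (u : ℝ → ℂ) (x : ℝ) : ‖flip T a u x‖ = ‖u x‖ := by
  unfold flip
  split_ifs
  · rfl
  · exact T.norm_map _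

theorem memLp_flip (T : ℂ ≃ₗᵢ[ℝ] ℂ) (a : ℝ) {u : ℝ → ℂ} (hu : MemLp u 2 volume) :
    MemLp (flip T a u) 2 volume := by
  refine hu.congr_norm ?_ (.of_forall fun x => (norm_flip T a u x).symm)
  have : flip T a u = fun x => (Set.Iic a).indicator u x +
      (Set.Ioi a).indicator (fun x => T (u x)) x := by
    funext x
    unfold flip
    by_cases hx : x ≤ a
    · simp [hx]
    · simp [hx, not_le.1 hx]
  rw [this]
  exact (hu.1.indicator measurableSet_Iic).add
    ((T.continuous.comp_aestronglyMeasurable hu.1).indicator measurableSet_Ioi)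

/-- Since `T` fixes `u a`, the two pieces join continuously, so the glued function is a primitive of
the glued derivative. -/
theorem Admissible.flip {V : ℝ → ℝ} {u g : ℝ → ℂ} (h : Admissible V u g) (T : ℂ ≃ₗᵢ[ℝ] ℂ) {a : ℝ}
    (hT : T (u a) = u a) : Admissible V (flip T a u) (flip T a g) := by
  have hm := memLp_flip T a h.memLp_deriv
  refine ⟨?_, memLp_flip T a h.memLp, hm, ?_⟩
  · have hprim := isPrimitive_integral hm.locallyIntegrable_of_two (u a) a
    have : NLS.flip T a u = fun x => u a + ∫ t in a..x, NLS.flip T a g t := by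
      funext x
      by_cases hx : x ≤ a
      · rw [NLS.flip, if_pos hx, h.isPrimitive.eq_add a x]
        congr 1
        refine intervalIntegral.integral_congr fun t ht => ?_
        rw [Set.uIcc_of_ge hx] at ht
        exact (if_pos ht.2).symm
      · rw [NLS.flip, if_neg hx, h.isPrimitive.eq_add a x, map_add, hT]
        congr 1
        have h1 := (T.toContinuousLinearEquiv : ℂ →L[ℝ] ℂ).intervalIntegral_comp_comm
          (h.isPrimitive.locallyIntegrable.intervalIntegrable_real a x)
        refine h1.symm.trans (intervalIntegral.integral_congr_ae (.of_forall fun t ht => ?_))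
        rw [Set.uIoc_of_le (not_le.1 hx).le] at ht
        exact (if_neg (not_le.2 ht.1)).symm
    rw [this]
    exact hprim
  · simpa only [norm_flip] using h.integrable

/-- `quad` and `power` see only pointwise norms, which an isometry preserves. -/
theorem Optimal.flip {V : ℝ → ℝ} {p ω : ℝ} {u g : ℝ → ℂ} (h : Optimal V p ω u g)
    (T : ℂ ≃ₗᵢ[ℝ] ℂ) {a : ℝ} (hT : T (u a) = u a) :
    Optimal V p ω (flip T a u) (flip T a g) := by
  have h1 : power p (NLS.flip T a u) = power p u := by simp only [power, norm_flip]
  have h2 : quad V ω (NLS.flip T a u) (NLS.flip T a g) = quad V ω u g := by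
    simp only [quad, norm_flip]
  refine ⟨h.admissible.flip T hT, ?_, ?_, ?_⟩
  · rw [h1]; exact h.power_pos
  · rw [h1, h2]; exact h.quad_eq
  · rw [h1]; exact h.le

/-- By the Euler-Lagrange equation `g` agrees almost everywhere with a continuous primitive of `(V +
ω - |u|^(p-1)) u`, so `u` is a primitive of a continuous function. -/
theorem Optimal.exists_regular {V : ℝ → ℝ} {p ω : ℝ} {u g : ℝ → ℂ}
    (hV : LocallyIntegrable V volume) (hp : 1 < p) (hu : Optimal V p ω u g) :
    ∃ d : ℝ → ℂ, (∀ x, HasDerivAt u (d x) x) ∧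
      IsPrimitive d (fun x => (V x + ω - ‖u x‖ ^ (p - 1)) • u x) := by
  obtain ⟨d, hgd, hd⟩ := (hu.hasWeakDeriv_deriv hV hp).exists_isPrimitive
  exact ⟨d, (hu.admissible.isPrimitive.congr_ae hgd).hasDerivAt hd.continuous, hd⟩

/-- The flipped function is optimal too, hence differentiable at `a`; its left derivative there is
`d a` and its right derivative is `T (d a)`. -/
theorem Optimal.map_deriv_eq {V : ℝ → ℝ} {p ω : ℝ} {u g d : ℝ → ℂ}
    (hV : LocallyIntegrable V volume) (hp : 1 < p) (hu : Optimal V p ω u g)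
    (hd : ∀ x, HasDerivAt u (d x) x) (T : ℂ ≃ₗᵢ[ℝ] ℂ) {a : ℝ} (hT : T (u a) = u a) :
    T (d a) = d a := by
  obtain ⟨e, he, -⟩ := (hu.flip T hT).exists_regular hV hp
  have h1 : HasDerivWithinAt u (e a) (Set.Iic a) a :=
    (he a).hasDerivWithinAt.congr (fun x hx => (if_pos hx).symm) (if_pos le_rfl).symm
  have h2 : HasDerivWithinAt (fun x => T (u x)) (e a) (Set.Ici a) a := by
    refine (he a).hasDerivWithinAt.congr (fun x hx => ?_) ?_
    · rcases (Set.mem_Ici.1 hx).eq_or_lt with rfl | hx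
      · rw [NLS.flip, if_pos le_rfl, hT]
      · exact (if_neg (not_le.2 hx)).symm
    · rw [NLS.flip, if_pos le_rfl, hT]
  have h3 : HasDerivWithinAt (fun x => T (u x)) (T (d a)) (Set.Ici a) a :=
    ((T.toContinuousLinearEquiv : ℂ →L[ℝ] ℂ).hasFDerivAt.comp_hasDerivAt a (hd a)).hasDerivWithinAt
  rw [(uniqueDiffWithinAt_Ici a).eq_deriv _ h3 h2]
  exact ((uniqueDiffWithinAt_Iic a).eq_deriv _ (hd a).hasDerivWithinAt h1).symm

/-! ### Uniqueness for the linear equation and absence of zeros -/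

/-- On `[a - δ, a + δ]` let `M` be the maximum of `|u|`. Integrating twice from `a` gives `|d| ≤ A
M` and then `M ≤ A M δ ≤ M / 2`, so `M = 0`. -/
theorem eventually_eq_zero_of_ode {u d : ℝ → ℂ} {q : ℝ → ℝ} (hq : LocallyIntegrable q volume)
    (hu : IsPrimitive u d) (hd : IsPrimitive d (fun x => q x • u x)) {a : ℝ} (hua : u a = 0)
    (hda : d a = 0) : ∀ᶠ x in nhds a, u x = 0 ∧ d x = 0 := by
  have hqi : IntegrableOn q (Set.Icc (a - 1) (a + 1)) volume :=
    hq.integrableOn_isCompact isCompact_Icc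
  set A := ∫ t in Set.Icc (a - 1) (a + 1), ‖q t‖ with hA
  have hA0 : 0 ≤ A := integral_nonneg fun t => norm_nonneg _
  set δ : ℝ := 1 / (2 * (A + 1)) with hδ
  have hδ0 : 0 < δ := by positivity
  have hδA : A * δ ≤ 1 / 2 := by
    rw [hδ, mul_one_div, div_le_iff₀ (by positivity)]; linarith
  have hδ1 : δ ≤ 1 := by
    rw [hδ, div_le_one (by positivity)]; linarith
  obtain ⟨y, hy, hmax⟩ := (isCompact_Icc (a := a - δ) (b := a + δ)).exists_isMaxOn
    ⟨a, by constructor <;> linarith⟩ hu.continuous.norm.continuousOn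
  set M := ‖u y‖ with hM
  have hsub : ∀ x ∈ Set.Icc (a - δ) (a + δ), Set.uIoc a x ⊆ Set.Icc (a - δ) (a + δ) := by
    intro x hx
    exact Set.uIoc_subset_uIcc.trans
      (Set.uIcc_subset_Icc (by constructor <;> linarith) hx)
  have hsub1 : Set.Icc (a - δ) (a + δ) ⊆ Set.Icc (a - 1) (a + 1) :=
    Set.Icc_subset_Icc (by linarith) (by linarith)
  have hdb : ∀ x ∈ Set.Icc (a - δ) (a + δ), ‖d x‖ ≤ A * M := by
    intro x hx
    rw [hd.eq_add a x, hda, zero_add]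
    refine intervalIntegral.norm_integral_le_integral_norm_uIoc.trans ?_
    calc ∫ t in Set.uIoc a x, ‖q t • u t‖ ≤ ∫ t in Set.uIoc a x, ‖q t‖ * M := by
          refine setIntegral_mono_on ?_ ?_ measurableSet_uIoc fun t ht => ?_
          · exact ((hd.locallyIntegrable.integrableOn_isCompact isCompact_Icc).mono_set
              (hsub x hx)).norm
          · exact ((hqi.mono_set ((hsub x hx).trans hsub1)).norm).mul_const M
          · rw [norm_smul]
            exact mul_le_mul_of_nonneg_left (hmax (hsub x hx ht)) (norm_nonneg _)
      _ ≤ ∫ t in Set.Icc (a - 1) (a + 1), ‖q t‖ * M :=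
          setIntegral_mono_set (hqi.norm.mul_const M)
            (.of_forall fun t => mul_nonneg (norm_nonneg _) (norm_nonneg _))
            ((hsub x hx).trans hsub1).eventuallyLE
      _ = A * M := integral_mul_const _ _
  have hM0 : M = 0 := by
    have h1 : M ≤ A * M * |y - a| := by
      rw [hM, hu.eq_add a y, hua, zero_add]
      have := intervalIntegral.norm_integral_le_of_norm_le_const (a := a) (b := y) (C := A * M)
        fun t ht => hdb t (hsub y hy ht)
      rw [hM, hu.eq_add a y, hua, zero_add] at this
      exact this
    have h2 : |y - a| ≤ δ := by
      rw [abs_le]; constructor <;> linarith [hy.1, hy.2]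
    have h3 : 0 ≤ M := norm_nonneg _
    have h4 : A * M * |y - a| ≤ A * M * δ := by gcongr
    nlinarith
  filter_upwards [Icc_mem_nhds (show a - δ < a by linarith) (show a < a + δ by linarith)] with x hx
  constructor
  · have : ‖u x‖ ≤ M := hmax hx
    rw [hM0] at this
    exact norm_le_zero_iff.1 this
  · have := hdb x hx
    rw [hM0, mul_zero] at this
    exact norm_le_zero_iff.1 this

/-- Uniqueness for the second-order linear equation `u'' = q u` with `q` locally integrable. -/
theorem eq_zero_of_ode {u d : ℝ → ℂ} {q : ℝ → ℝ} (hq : LocallyIntegrable q volume)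
    (hu : IsPrimitive u d) (hd : IsPrimitive d (fun x => q x • u x)) {a : ℝ} (hua : u a = 0)
    (hda : d a = 0) (x : ℝ) : u x = 0 := by
  have hclosed : IsClosed {x | u x = 0 ∧ d x = 0} :=
    (isClosed_eq hu.continuous continuous_const).inter (isClosed_eq hd.continuous continuous_const)
  have hopen : IsOpen {x | u x = 0 ∧ d x = 0} := isOpen_iff_mem_nhds.2 fun y hy =>
    eventually_eq_zero_of_ode hq hu hd hy.1 hy.2
  have := IsClopen.eq_univ ⟨hclosed, hopen⟩ ⟨a, hua, hda⟩
  exact (Set.eq_univ_iff_forall.1 this x).1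

/-- At a zero of `u` the isometry `-1` fixes `u a`, so the derivative vanishes as well. With `V + ω
- |u|^(p-1)` frozen as a coefficient, the equation is linear and `u` vanishes identically, against
`power_pos`. -/
theorem Optimal.ne_zero {V : ℝ → ℝ} {p ω : ℝ} {u g : ℝ → ℂ}
    (hV : LocallyIntegrable V volume) (hp : 1 < p) (hu : Optimal V p ω u g) (a : ℝ) : u a ≠ 0 := by
  intro ha
  obtain ⟨d, hd, hdp⟩ := hu.exists_regular hV hp
  have huc := hu.admissible.isPrimitive.continuous
  have h1 := hu.map_deriv_eq hV hp hd (LinearIsometryEquiv.neg ℝ) (a := a) (by simp [ha])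
  have hda : d a = 0 := by
    simpa using self_eq_neg.1 (h1.symm.trans (LinearIsometryEquiv.coe_neg (R := ℝ) (E := ℂ) ▸ rfl))
  have hup : IsPrimitive u d := ⟨hdp.continuous.locallyIntegrable, fun x y =>
    (intervalIntegral.integral_eq_sub_of_hasDerivAt (fun t _ => hd t)
      (hdp.continuous.intervalIntegrable x y)).symm⟩
  have hz := eq_zero_of_ode (locallyIntegrable_potential (ω := ω) hV huc hp) hup hdp ha hda
  have hpos := hu.power_pos
  have hpp : p + 1 ≠ 0 := by linarith
  simp [power, hz, Real.zero_rpow hpp] at hpos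

/-! ### Constant phase -/

/-- The logarithmic derivative `a` is real and continuous, so `u = exp (∫ a) * u 0`, and rotating by
minus the argument of `u 0` makes every value positive. -/
theorem exists_rotation_of_deriv_real_multiple {u d : ℝ → ℂ} (hd : ∀ x, HasDerivAt u (d x) x)
    (hdc : Continuous d) (hu : ∀ x, u x ≠ 0) (h : ∀ x, ∃ a : ℝ, a • u x = d x) :
    ∃ θ : ℝ, ∃ v : ℝ → ℝ, Continuous v ∧ (∀ x, 0 < v x) ∧
      ∀ x, Complex.exp ((θ : ℂ) * Complex.I) * u x = ((v x : ℝ) : ℂ) := by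
  have huc : Continuous u := continuous_iff_continuousAt.2 fun x => (hd x).continuousAt
  set a : ℝ → ℝ := fun x => (d x / u x).re with ha
  have hac : Continuous a := Complex.continuous_re.comp (hdc.div huc hu)
  have had : ∀ x, (a x : ℂ) * u x = d x := fun x => by
    obtain ⟨b, hb⟩ := h x
    have : d x / u x = (b : ℂ) := by
      rw [← hb, Complex.real_smul, mul_div_cancel_right₀ _ (hu x)]
    rw [ha]
    simp only [this, Complex.ofReal_re]
    rw [← hb, Complex.real_smul]
  set F : ℝ → ℝ := fun x => ∫ t in (0 : ℝ)..x, a t with hF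
  have hFd : ∀ x, HasDerivAt F (a x) x := fun x => (hac.integral_hasStrictDerivAt 0 x).hasDerivAt
  have hFc : Continuous F := continuous_iff_continuousAt.2 fun x => (hFd x).continuousAt
  have hW : ∀ x, HasDerivAt (fun x => ((Real.exp (-F x) : ℝ) : ℂ) * u x) 0 x := fun x => by
    have h1 := ((hFd x).neg.exp.ofReal_comp).mul (hd x)
    refine h1.congr_deriv ?_
    rw [← had x]
    push_cast
    ring
  have hconst : ∀ x, ((Real.exp (-F x) : ℝ) : ℂ) * u x = u 0 := fun x => by
    have := is_const_of_deriv_eq_zero (fun x => (hW x).differentiableAt) (fun x => (hW x).deriv) x 0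
    simpa [hF] using this
  have hux : ∀ x, u x = ((Real.exp (F x) : ℝ) : ℂ) * u 0 := fun x => by
    rw [← hconst x, ← mul_assoc, ← Complex.ofReal_mul, ← Real.exp_add, add_neg_cancel,
      Real.exp_zero, Complex.ofReal_one, one_mul]
  refine ⟨-Complex.arg (u 0), fun x => Real.exp (F x) * ‖u 0‖,
    (Real.continuous_exp.comp hFc).mul continuous_const,
    fun x => mul_pos (Real.exp_pos _) (norm_pos_iff.2 (hu 0)), fun x => ?_⟩
  have h0 : Complex.exp (((-Complex.arg (u 0) : ℝ) : ℂ) * Complex.I) * u 0 = (‖u 0‖ : ℂ) := by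
    calc _ = Complex.exp (((-Complex.arg (u 0) : ℝ) : ℂ) * Complex.I) *
          (‖u 0‖ * Complex.exp (Complex.arg (u 0) * Complex.I)) := by
          rw [Complex.norm_mul_exp_arg_mul_I]
      _ = (‖u 0‖ : ℂ) := by
          rw [mul_left_comm, ← Complex.exp_add]
          simp
  rw [hux x, mul_left_comm, h0]
  push_cast
  ring

theorem Optimal.exists_rotation {V : ℝ → ℝ} {p ω : ℝ} {u g : ℝ → ℂ}
    (hV : LocallyIntegrable V volume) (hp : 1 < p) (hu : Optimal V p ω u g) :
    ∃ θ : ℝ, ∃ v : ℝ → ℝ, Continuous v ∧ (∀ x, 0 < v x) ∧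
      ∀ x, Complex.exp ((θ : ℂ) * Complex.I) * u x = ((v x : ℝ) : ℂ) := by
  obtain ⟨d, hd, hdp⟩ := hu.exists_regular hV hp
  refine exists_rotation_of_deriv_real_multiple hd hdp.continuous (hu.ne_zero hV hp) fun x => ?_
  -- The fixed points of the reflection in the real line through `u x` are exactly the real
  -- multiples of `u x`.
  have h1 := hu.map_deriv_eq hV hp hd (Submodule.span ℝ {u x}).reflection (a := x)
    (Submodule.reflection_mem_subspace_eq_self (Submodule.mem_span_singleton_self _))
  exact Submodule.mem_span_singleton.1 ((Submodule.reflection_eq_self_iff _).1 h1)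

end NLS

end

theorem theorem3p1 (V : ℝ → ℝ) (hV : NLS.CondV1 V) (p ω : ℝ) (hp : 1 < p)
    (hω : NLS.omega1 V < (ω : EReal)) (u : ℝ → ℂ) (hu : u ∈ NLS.minimizers V p ω) :
    ∃ θ : ℝ, ∃ v : ℝ → ℝ, Continuous v ∧ (∀ x, 0 < v x) ∧
      (fun x => Complex.exp ((θ : ℂ) * Complex.I) * u x) =ᵐ[volume] fun x => ((v x : ℝ) : ℂ) := by
  obtain ⟨w, g, huw, hw⟩ := NLS.exists_optimal_of_mem_minimizers hV hp hω hu
  obtain ⟨θ, v, hv, hpos, h⟩ := hw.exists_rotation hV.locallyIntegrable hp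
  refine ⟨θ, v, hv, hpos, ?_⟩
  filter_upwards [huw] with x hx
  rw [hx, h]
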